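/- All ordinals carry the order topology, and an ordinal $\lambda$ is identified with the space of ordinals smaller than $\lambda$. A map $f\colon X\to Y$ *cleaves along* $A\subseteq X$ if $f(A)\cap f(X\setminus A)=\emptyset$; a space $X$ is *cleavable over* $Y$ if for every $A\subseteq X$ some continuous $f\colon X\to Y$ cleaves along $A$. A space is *scattered* if it has no nonempty dense-in-itself subset. Let $X^{0}=X$, $X^{\alpha+1}=(X^{\alpha})'$ (the set of accumulation points of $X^\alpha$), $X^{\lambda}=\bigcap_{\alpha<\lambda}X^{\alpha}$ for limit $\lambda$; the Cantor–Bendixson rank $\mathrm{CB}(X)$ is the least $\alpha$ with $X^{\alpha+1}=X^{\alpha}$. A compact scattered space $X$ with $\mathrm{CB}(X)=\beta+1$ is *simple with* $\hat x$ if $X^{\beta}=\{\hat x\}$, and *simple* if it is simple with some point. Let $\lambda$ be an ordinal and let $A$ be an infinite compact space that is simple with $\hat x$. A *spine* of $A$ (over $\lambda$) is a pair $(S,k)$ where $S\subseteq A\setminus\{\hat x\}$ and $k\colon A\to\lambda$ is continuous, such that (1) $k$ cleaves along $S$; (2) $k|_S$ is a topological embedding into $\lambda$; (3) $k(\hat x)$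 is a limit ordinal and $k(S)$ is a closed unbounded subset of $k(\hat x)$. If $X$ is cleavable over $\lambda$, then $X$ *hereditarily has a spine* (over $\lambda$) if every closed, infinite, simple subspace $A\subseteq X$ has a spine over $\lambda$. **Theorem.** Let $X$ be a compact space that is cleavable over an ordinal $\lambda$. If $X$ hereditarily has a spine over $\lambda$, then $X$ is homeomorphic to an ordinal. -/

import Mathlib

universe u v w

namespace OrdinalCleavability

open Set Topology CantorBendixson

/-- The map `f` cleaves `X` along `A`: the images of `A` and of its complement are disjoint. -/
def CleavesAlong {X : Type v} {Y : Type w} (f : X → Y) (A : Set X) : Prop :=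
  Disjoint (f '' A) (f '' Aᶜ)

/-- `X` is cleavable over `Y`: along every subset of `X` some continuous map to `Y` cleaves. -/
def CleavableOver (X : Type v) (Y : Type w) [TopologicalSpace X] [TopologicalSpace Y] : Prop :=
  ∀ A : Set X, ∃ f : X → Y, Continuous f ∧ CleavesAlong f A

/-- A space is scattered if it has no nonempty dense-in-itself subset. -/
def IsScattered (X : Type v) [TopologicalSpace X] : Prop :=
  ∀ s : Set X, Preperfect s → s = ∅

/-- The `a`-th derived set of the whole space `X`. (All stages are closed, so the relative derived
set used in Mathlib at successor stages is the usual derived set.) -/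
def derived (X : Type u) [TopologicalSpace X] (a : Ordinal.{u}) : Set X :=
  iteratedDerivedSet (univ : Set X) a

/-- The Cantor-Bendixson rank: the least ordinal at which the derived sets stabilize. -/
noncomputable def cbRank (X : Type u) [TopologicalSpace X] : Ordinal.{u} :=
  sInf {a | derived X (a + 1) = derived X a}

/-- `X` is simple with `x`: a compact scattered space of Cantor-Bendixson rank `b + 1` such that
`x` is the only element of the `b`-th derived set. -/
def IsSimpleWith (X : Type u) [TopologicalSpace X] (x : X) : Prop :=
  CompactSpace X ∧ IsScattered X ∧ ∃ b : Ordinal.{u}, cbRank X = b + 1 ∧ derived X b = {x}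

/-- `X` is simple: it is simple with some point. -/
def IsSimple (X : Type u) [TopologicalSpace X] : Prop :=
  ∃ x : X, IsSimpleWith X x

/-- `C` is a closed unbounded subset of the limit ordinal `a`. -/
def IsClubIn (C : Set Ordinal.{v}) (a : Ordinal.{v}) : Prop :=
  Order.IsSuccLimit a ∧ C ⊆ Iio a ∧ IsClub ((↑) ⁻¹' C : Set (Iio a))

/-- `(S, k)` is a spine, over the ordinal `l = Iio l`, of the space `X` that is simple with `x`. -/
structure IsSpine {X : Type u} [TopologicalSpace X] {l : Ordinal.{v}} (x : X) (S : Set X)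
    (k : X → Iio l) : Prop where
  notMem : x ∉ S
  continuous : Continuous k
  cleaves : CleavesAlong k S
  embedding : IsEmbedding (S.domRestrict k)
  club : IsClubIn ((fun s => (k s : Ordinal.{v})) '' S) (k x : Ordinal.{v})

/-- The space `X` is simple with some point and has a spine over the ordinal `l`. -/
def HasSpine (X : Type u) [TopologicalSpace X] (l : Ordinal.{v}) : Prop :=
  ∃ x : X, IsSimpleWith X x ∧ ∃ (S : Set X) (k : X → Iio l), IsSpine x S k

/-- Every closed, infinite, simple subspace of `X` has a spine over the ordinal `l`. -/
def HereditarilyHasSpine (X : Type u) [TopologicalSpace X] (l : Ordinal.{v}) : Prop :=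
  ∀ A : Set X, IsClosed A → A.Infinite → IsSimple A → HasSpine A l

end OrdinalCleavability

namespace OrdinalCleavability

open Set Topology Filter

/-! ### Closed unbounded sets below an ordinal of uncountable cofinality -/

/-! Cleaving along `{x}` and truncating gives a continuous `f` into the ordinals with a strict
maximum at `x` (`exists_isPeak`); by compactness the clopen sets `{f > b}`, `b < f x`, form a
neighbourhood base at `x`. Since every nonempty subset has an isolated point (`exists_isolated`),
everything reduces to a local step: if all closed sets missing `x` inject continuously into the
ordinals, so does the whole space (`injectsInOrdinal_of_forall_notMem`). A compact space with such
an injection is an ordinal.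

For the local step with `x` not isolated, an increasing clopen family, gaining at most one point at
each limit index, lets the injections of the successive differences be concatenated
(`injectsInOrdinal_of_filtration`). In countable cofinality, sets `{f ≤ a}` along a sequence
suffice. In uncountable cofinality, choose a point `c a` on each boundary level and a set `T` that
neither includes nor misses a club (`exists_bistationary`). Separating `x` and the chosen points
over levels outside `T` from all other points makes `{f < a} ∪ {c a}` clopen for all `a ∉ T` in a
club; exchanging `T` with its complement covers all levels of a club. -/

/-- `o` is a limit ordinal or zero in which every sequence is bounded. -/
structure UncountableCofinality (o : Ordinal.{u}) : Prop where
  add_one_lt : ∀ b < o, b + 1 < o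
  bounded : ∀ s : ℕ → Ordinal.{u}, (∀ n, s n < o) → ∃ c < o, ∀ n, s n ≤ c

/-- `C` is a set of ordinals that is closed and unbounded below `o`. -/
structure ClubBelow (o : Ordinal.{u}) (C : Set Ordinal.{u}) : Prop where
  lt : ∀ a ∈ C, a < o
  unbounded : ∀ b < o, ∃ a ∈ C, b < a
  closed : ∀ a < o, 0 < a → (∀ b < a, ∃ c ∈ C, b < c ∧ c < a) → a ∈ C

/-- The ordinals below `o` that are closed under a total relation form a club. -/
theorem clubBelow_closure {o : Ordinal.{u}} (ho : UncountableCofinality o)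
    (R : Ordinal.{u} → Ordinal.{u} → Prop)
    (anti : ∀ b b' c, b ≤ b' → R b' c → R b c) (total : ∀ b < o, ∃ c < o, R b c) :
    ClubBelow o {a | a < o ∧ 0 < a ∧ ∀ b < a, ∃ c < a, R b c} := by
  refine ⟨fun a ha => ha.1, fun b hb => ?_, fun a ha h0 h => ⟨ha, h0, fun b hb => ?_⟩⟩
  -- Iterate `ω` times; the supremum stays below `o` and is closed under `R`. The `x + 1` makes the
  -- sequence strictly increasing.
  · have step : ∀ x : Iio o, ∃ y : Iio o, x.1 < y.1 ∧ ∃ c ≤ y.1, R x.1 c := by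
      rintro ⟨x, hx⟩
      obtain ⟨c, hc, hR⟩ := total x hx
      exact ⟨⟨max c (x + 1), max_lt hc (ho.add_one_lt x hx)⟩,
        (lt_add_one x).trans_le (le_max_right _ _), c, le_max_left _ _, hR⟩
    choose φ hφ hφR using step
    let s : ℕ → Iio o := fun n => φ^[n] ⟨b, hb⟩
    have hs : ∀ n, s (n + 1) = φ (s n) := fun n => Function.iterate_succ_apply' φ n _
    obtain ⟨d, hd, hsd⟩ := ho.bounded (fun n => (s n).1) fun n => (s n).2
    have hlt : ∀ n, (s n).1 < ⨆ n, (s n).1 := fun n =>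
      ((hφ (s n)).trans_eq (by rw [hs])).trans_le (Ordinal.le_iSup (fun n => (s n).1) (n + 1))
    refine ⟨⨆ n, (s n).1, ⟨(Ordinal.iSup_le hsd).trans_lt hd, ?_, fun x hx => ?_⟩, hlt 0⟩
    · exact zero_le.trans_lt (hlt 0)
    · obtain ⟨n, hn⟩ := Ordinal.lt_iSup_iff.1 hx
      obtain ⟨c, hc, hR⟩ := hφR (s n)
      refine ⟨c, hc.trans_lt ?_, anti _ _ _ hn.le hR⟩
      rw [← hs]
      exact hlt _
  · obtain ⟨c, hc, hbc, hca⟩ := h b hb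
    obtain ⟨d, hd, hR⟩ := hc.2.2 b hbc
    exact ⟨d, hd.trans hca, hR⟩

/-- An ordinal closed under "every `C n` meets `(b, c]`" is a limit of each `C n`, hence lies in all
of them. -/
theorem ClubBelow.iInter {o : Ordinal.{u}} (ho : UncountableCofinality o)
    {C : ℕ → Set Ordinal.{u}} (hC : ∀ n, ClubBelow o (C n)) : ClubBelow o (⋂ n, C n) := by
  have key := clubBelow_closure ho (fun b c => ∀ n, ∃ d ∈ C n, b < d ∧ d ≤ c)
    (fun b b' c hb h n => (h n).imp fun d hd => ⟨hd.1, hb.trans_lt hd.2.1, hd.2.2⟩) (by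
      intro b hb
      choose d hd hbd using fun n => (hC n).unbounded b hb
      obtain ⟨c, hc, hdc⟩ := ho.bounded d fun n => (hC n).lt _ (hd n)
      exact ⟨c, hc, fun n => ⟨d n, hd n, hbd n, hdc n⟩⟩)
  refine ⟨fun a ha => (hC 0).lt a (mem_iInter.1 ha 0), fun b hb => ?_, fun a ha h0 h =>
    mem_iInter.2 fun n => (hC n).closed a ha h0 fun b hb => ?_⟩
  · obtain ⟨a, ⟨ha, h0, hR⟩, hba⟩ := key.unbounded b hb
    refine ⟨a, mem_iInter.2 fun n => (hC n).closed a ha h0 fun x hx => ?_, hba⟩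
    obtain ⟨c, hc, hd⟩ := hR x hx
    obtain ⟨d, hdC, hxd, hdc⟩ := hd n
    exact ⟨d, hdC, hxd, hdc.trans_lt hc⟩
  · obtain ⟨c, hc, h⟩ := h b hb
    exact ⟨c, mem_iInter.1 hc n, h⟩

theorem ClubBelow.inter {o : Ordinal.{u}} (ho : UncountableCofinality o)
    {C D : Set Ordinal.{u}} (hC : ClubBelow o C) (hD : ClubBelow o D) : ClubBelow o (C ∩ D) := by
  have h := ClubBelow.iInter ho (C := fun n => if n = 0 then C else D)
    (fun n => by split_ifs <;> assumption)
  convert h using 1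
  ext a
  simp only [mem_inter_iff, mem_iInter]
  refine ⟨fun h n => ?_, fun h => ⟨by simpa using h 0, by simpa using h 1⟩⟩
  split_ifs
  exacts [h.1, h.2]

/-- Below a point that is not one of its limits, a club is empty or has a greatest element. -/
theorem ClubBelow.exists_max {o : Ordinal.{u}} {C : Set Ordinal.{u}} (hC : ClubBelow o C)
    {a : Ordinal.{u}} (ha : a < o) (hlim : ¬ ∀ b < a, ∃ c ∈ C, b < c ∧ c < a) :
    (∀ c ∈ C, ¬ c < a) ∨ ∃ d ∈ C, d < a ∧ ∀ c ∈ C, c < a → c ≤ d := by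
  by_contra hcon
  push Not at hlim hcon
  obtain ⟨⟨c₀, hc₀, hc₀a⟩, hmax⟩ := hcon
  obtain ⟨b, hb, hbC⟩ := hlim
  -- The supremum of `C` below `a`: if not attained, it is a limit of `C`, so it belongs to `C`
  -- after all.
  let d := sInf {x | ∀ c ∈ C, c < a → c ≤ x}
  have hne : {x | ∀ c ∈ C, c < a → c ≤ x}.Nonempty := ⟨a, fun c _ hc => hc.le⟩
  have hd : ∀ c ∈ C, c < a → c ≤ d := csInf_mem hne
  have hda : d < a := (csInf_le' fun c hc hca => not_lt.1 fun h =>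
    (hbC c hc h).not_gt hca : d ≤ b).trans_lt hb
  have hlt : ∀ c ∈ C, c < a → c < d := fun c hc hca => (hd c hc hca).lt_of_ne (by
    rintro rfl
    obtain ⟨x, hx, hxa, h⟩ := hmax _ hc hca
    exact h.not_ge (hd x hx hxa))
  have hdC : d ∈ C := hC.closed d (hda.trans ha) (zero_le.trans_lt (hlt c₀ hc₀ hc₀a)) (by
    intro x hx
    by_contra hcon
    push Not at hcon
    refine hx.not_ge (csInf_le' fun c hc hca => not_lt.1 fun h => ?_)
    exact (hcon c hc h).not_gt (hlt c hc hca))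
  exact (hlt d hdC hda).false

theorem ClubBelow.nonempty {o : Ordinal.{u}} {C : Set Ordinal.{u}} (hC : ClubBelow o C)
    (h0 : 0 < o) : C.Nonempty :=
  let ⟨a, ha, _⟩ := hC.unbounded 0 h0
  ⟨a, ha⟩

/-- If `o` is bounded for families indexed by the Cantor space, then every club
contains an ordinal that is not the limit of a sequence. -/
theorem ClubBelow.exists_mem_uncountableCofinality {o : Ordinal.{u}}
    (ho : UncountableCofinality o) (h0 : 0 < o)
    (hb : ∀ s : (ℕ → Bool) → Ordinal.{u}, (∀ i, s i < o) → ∃ c < o, ∀ i, s i ≤ c)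
    {C : Set Ordinal.{u}} (hC : ClubBelow o C) :
    ∃ a ∈ C, ¬ ∃ s : ℕ → Ordinal.{u}, (∀ n, s n < a) ∧ ∀ b < a, ∃ n, b ≤ s n := by
  have hunc : ¬ C.Countable := fun hcount => by
    obtain ⟨s, rfl⟩ := hcount.exists_eq_range (hC.nonempty h0)
    obtain ⟨c, hc, hsc⟩ := ho.bounded s fun n => hC.lt _ ⟨n, rfl⟩
    obtain ⟨_, ⟨n, rfl⟩, hn⟩ := hC.unbounded c hc
    exact (hsc n).not_gt hn
  -- As `ℵ₁ ≤ 2^ℵ₀`, a subset of `C` of size `ℵ₁` can be indexed by the Cantor space, so it is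
  -- bounded below `o`.
  obtain ⟨I, hIC, hI⟩ : ∃ I ⊆ C, Cardinal.mk I = Cardinal.aleph 1 := by
    apply Cardinal.le_mk_iff_exists_subset.1
    rw [← Cardinal.succ_aleph0, Order.succ_le_iff]
    exact not_le.1 fun h => hunc (Cardinal.le_aleph0_iff_set_countable.1 h)
  have hIunc : ¬ I.Countable := fun h => by
    have := Cardinal.le_aleph0_iff_set_countable.2 h
    rw [hI] at this
    exact this.not_gt Cardinal.aleph0_lt_aleph_one
  obtain ⟨j⟩ : Nonempty (I ↪ (ℕ → Bool)) := by
    apply Cardinal.lift_mk_le'.1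
    rw [hI]
    simpa using Cardinal.aleph_one_le_continuum
  classical
  obtain ⟨c, hc, hIc⟩ := hb (fun i => if h : ∃ x, j x = i then (h.choose : Ordinal.{u}) else 0)
    (fun i => by
      split_ifs with h
      exacts [hC.lt _ (hIC h.choose.2), h0])
  have hIle : ∀ x ∈ I, x ≤ c := fun x hx => by
    have hex : ∃ y, j y = j ⟨x, hx⟩ := ⟨_, rfl⟩
    have := hIc (j ⟨x, hx⟩)
    rw [dif_pos hex, j.injective hex.choose_spec] at this
    exact this
  -- Minimality makes `a` a limit of `C`; a sequence cofinal in `a` would make `C` below `a` a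
  -- countable union of countable sets.
  set a := sInf {a | ¬ (C ∩ Iio a).Countable}
  have hmem : c + 1 ∈ {a | ¬ (C ∩ Iio a).Countable} := fun h =>
    hIunc (h.mono fun x hx => show x ∈ C ∩ Iio (c + 1) from
      ⟨hIC hx, Order.lt_add_one_iff.2 (hIle x hx)⟩)
  have ha : ¬ (C ∩ Iio a).Countable := csInf_mem (s := {a | ¬ (C ∩ Iio a).Countable}) ⟨_, hmem⟩
  have hao : a < o := (csInf_le' hmem).trans_lt (ho.add_one_lt c hc)
  have hlt : ∀ b < a, (C ∩ Iio b).Countable := fun b hb => by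
    by_contra h
    exact hb.not_ge (csInf_le' h)
  have hle : ∀ b < a, (C ∩ Iic b).Countable := fun b hb =>
    ((hlt b hb).union (countable_singleton b)).mono fun x hx =>
      hx.2.lt_or_eq.imp (fun h => ⟨hx.1, h⟩) id
  refine ⟨a, hC.closed a hao ?_ fun b hb => ?_, ?_⟩
  · refine pos_iff_ne_zero.2 fun h => ha ?_
    rw [h]
    exact countable_empty.mono fun x hx => (not_lt_zero (show x < 0 from hx.2)).elim
  · by_contra hcon
    push Not at hcon
    exact ha ((hle b hb).mono fun x hx => show x ∈ C ∩ Iic b from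
      ⟨hx.1, not_lt.1 fun h => (hcon x hx.1 h).not_gt hx.2⟩)
  · rintro ⟨s, hs, hcof⟩
    refine ha ((countable_iUnion fun n => hle (s n) (hs n)).mono fun x hx => ?_)
    obtain ⟨n, hn⟩ := hcof x hx.2
    exact mem_iUnion.2 ⟨n, hx.1, hn⟩

/-- Below an ordinal of uncountable cofinality there is a set which neither includes nor misses
a club. -/
theorem exists_bistationary {o : Ordinal.{u}} (ho : UncountableCofinality o) (h0 : 0 < o) :
    ∃ T : Set Ordinal.{u}, ∀ C, ClubBelow o C → (∃ a ∈ C, a ∈ T) ∧ ∃ a ∈ C, a ∉ T := by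
  by_cases hb : ∀ s : (ℕ → Bool) → Ordinal.{u}, (∀ i, s i < o) → ∃ c < o, ∀ i, s i ≤ c
  · refine ⟨{a | ∃ s : ℕ → Ordinal.{u}, (∀ n, s n < a) ∧ ∀ b < a, ∃ n, b ≤ s n},
      fun C hC => ⟨?_, ClubBelow.exists_mem_uncountableCofinality ho h0 hb hC⟩⟩
    have step : ∀ x : C, ∃ y : C, x.1 < y.1 := fun x =>
      let ⟨y, hy, h⟩ := hC.unbounded x.1 (hC.lt _ x.2)
      ⟨⟨y, hy⟩, h⟩
    choose φ hφ using step
    obtain ⟨c₀, hc₀⟩ := hC.nonempty h0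
    let s : ℕ → C := fun n => φ^[n] ⟨c₀, hc₀⟩
    have hs : ∀ n, s (n + 1) = φ (s n) := fun n => Function.iterate_succ_apply' φ n _
    obtain ⟨d, hd, hsd⟩ := ho.bounded (fun n => (s n).1) fun n => hC.lt _ (s n).2
    have hlt : ∀ n, (s n).1 < ⨆ n, (s n).1 := fun n =>
      ((hφ (s n)).trans_eq (by rw [hs])).trans_le (Ordinal.le_iSup (fun n => (s n).1) (n + 1))
    refine ⟨⨆ n, (s n).1, hC.closed _ ((Ordinal.iSup_le hsd).trans_lt hd)
      (zero_le.trans_lt (hlt 0)) fun b hb => ?_, fun n => (s n).1, hlt, fun b hb => ?_⟩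
    · obtain ⟨n, hn⟩ := Ordinal.lt_iSup_iff.1 hb
      exact ⟨_, (s n).2, hn, hlt n⟩
    · obtain ⟨n, hn⟩ := Ordinal.lt_iSup_iff.1 hb
      exact ⟨n, hn.le⟩
  · push Not at hb
    obtain ⟨s, hs, hcof⟩ := hb
    -- Here the Cantor space maps cofinally into `o`. If every set included or missed a club, each
    -- coordinate of `ρ` would be constant on a club, so `ρ` would be constant on a club, which `s
    -- t` would then bound.
    have hρ : ∀ a : Ordinal.{u}, ∃ i, a < o → a < s i := fun a => by
      by_cases ha : a < o
      · obtain ⟨i, hi⟩ := hcof a ha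
        exact ⟨i, fun _ => hi⟩
      · exact ⟨fun _ => false, fun h => (ha h).elim⟩
    choose ρ hρ using hρ
    by_contra hcon
    push Not at hcon
    have hconst : ∀ n, ∃ C, ClubBelow o C ∧ ∃ t, ∀ a ∈ C, ρ a n = t := fun n => by
      obtain ⟨C, hC, h⟩ := hcon {a | ρ a n = true}
      refine ⟨C, hC, ?_⟩
      by_cases hex : ∃ a ∈ C, ρ a n = true
      · exact ⟨true, h hex⟩
      · push Not at hex
        exact ⟨false, fun a ha => by simpa using hex a ha⟩
    choose C hC t ht using hconst
    have hD := ClubBelow.iInter ho hC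
    have hρt : ∀ a ∈ ⋂ n, C n, ρ a = t := fun a ha => funext fun n => ht n a (mem_iInter.1 ha n)
    obtain ⟨a, ha, hlt⟩ := hD.unbounded (s t) (hs t)
    have := hρ a (hD.lt a ha)
    rw [hρt a ha] at this
    exact this.not_gt hlt

/-! ### Sets that embed into the ordinals -/

theorem isOpen_Iic_ordinal (a : Ordinal.{u}) : IsOpen (Iic a) := by
  rw [← Order.Iio_succ]
  exact isOpen_Iio

theorem isClosed_Ioi_ordinal (a : Ordinal.{u}) : IsClosed (Ioi a) := by
  rw [← compl_Iic]
  exact (isOpen_Iic_ordinal a).isClosed_compl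

/-- Some continuous map to the ordinals is injective on `K`. -/
def InjectsInOrdinal {X : Type u} [TopologicalSpace X] (K : Set X) : Prop :=
  ∃ k : X → Ordinal.{u}, ContinuousOn k K ∧ InjOn k K

section

variable {X : Type u} [TopologicalSpace X]

theorem InjectsInOrdinal.mono {K L : Set X} (hL : InjectsInOrdinal L) (h : K ⊆ L) :
    InjectsInOrdinal K :=
  let ⟨k, hc, hi⟩ := hL
  ⟨k, hc.mono h, hi.mono h⟩

/-- The values on `L \ K` are shifted above all those on `K`; addition on the left keeps this
continuous. -/
theorem InjectsInOrdinal.union {K L : Set X} (hK : InjectsInOrdinal K) (hL : InjectsInOrdinal L)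
    (hKo : IsClopen K) : InjectsInOrdinal (K ∪ L) := by
  classical
  obtain ⟨k, hkc, hki⟩ := hK
  obtain ⟨m, hmc, hmi⟩ := hL
  let M := ⨆ x, k x + 1
  have hM : ∀ x, k x < M := Ordinal.lt_iSup_add_one k
  refine ⟨fun x => if x ∈ K then k x else M + m x, ?_, ?_⟩
  · intro x hx
    by_cases hxK : x ∈ K
    · have h1 : ContinuousAt k x := hkc.continuousAt (hKo.isOpen.mem_nhds hxK)
      refine (h1.congr ?_).continuousWithinAt
      filter_upwards [hKo.isOpen.mem_nhds hxK] with y hy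
      exact (if_pos hy).symm
    · have h1 : ContinuousWithinAt (fun y => M + m y) (K ∪ L) x := by
        have hadd : Continuous fun a : Ordinal.{u} => M + a :=
          (Ordinal.isNormal_add_right M).continuous
        refine hadd.continuousAt.comp_continuousWithinAt ?_
        refine (hmc x (hx.resolve_left hxK)).mono_of_mem_nhdsWithin ?_
        filter_upwards [self_mem_nhdsWithin,
          mem_nhdsWithin_of_mem_nhds (hKo.compl.isOpen.mem_nhds hxK)] with y hy hyK
        exact hy.resolve_left hyK
      refine h1.congr_of_eventuallyEq ?_ (if_neg hxK)
      filter_upwards [mem_nhdsWithin_of_mem_nhds (hKo.compl.isOpen.mem_nhds hxK)] with y hyK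
      exact if_neg hyK
  · intro x hx y hy hxy
    dsimp only at hxy
    split_ifs at hxy with h1 h2 h2
    · exact hki h1 h2 hxy
    · exact absurd (hxy ▸ hM x) (not_lt.2 le_self_add)
    · exact absurd (hxy ▸ hM y) (not_lt.2 le_self_add)
    · exact hmi (hx.resolve_left h1) (hy.resolve_left h2) (by simpa using hxy)

/-- If every fibre of a continuous map to the ordinals is a singleton, or open and embeddable in
the ordinals, then the whole space is embeddable. -/
theorem injectsInOrdinal_of_fibres {h : X → Ordinal.{u}} (hc : Continuous h)
    (hf : ∀ y, h ⁻¹' {h y} = {y} ∨ IsOpen (h ⁻¹' {h y}) ∧ InjectsInOrdinal (h ⁻¹' {h y})) :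
    InjectsInOrdinal (univ : Set X) := by
  have hk : ∀ a : Ordinal.{u}, ∃ k : X → Ordinal.{u}, InjOn k (h ⁻¹' {a}) ∧
      ((∃ y, h y = a ∧ h ⁻¹' {a} = {y} ∧ k y = 0) ∨
        IsOpen (h ⁻¹' {a}) ∧ ContinuousOn k (h ⁻¹' {a})) := by
    intro a
    by_cases ha : ∃ y, h y = a
    · obtain ⟨y, rfl⟩ := ha
      rcases hf y with h1 | ⟨h1, k, hkc, hki⟩
      · refine ⟨fun _ => 0, ?_, Or.inl ⟨y, rfl, h1, rfl⟩⟩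
        rw [h1]
        exact injOn_singleton _ _
      · exact ⟨k, hki, Or.inr ⟨h1, hkc⟩⟩
    · have : h ⁻¹' {a} = ∅ := eq_empty_of_forall_notMem fun y hy => ha ⟨y, hy⟩
      rw [this]
      exact ⟨fun _ => 0, injOn_empty _, Or.inr ⟨isOpen_empty, continuousOn_empty _⟩⟩
  choose k hki hk using hk
  -- Lexicographic order: `M * h y` selects a block and `k` the place in it. A singleton fibre that
  -- need not be open sits at the start of its block (`k y = 0`), where the limit from below is
  -- attained.
  let M := ⨆ y, k (h y) y + 1
  have hM : ∀ y, k (h y) y < M := Ordinal.lt_iSup_add_one fun y => k (h y) y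
  have hub : ∀ y, M * h y + k (h y) y < M * (h y + 1) := fun y => by
    rw [mul_add_one]
    gcongr
    exact hM y
  refine ⟨fun y => M * h y + k (h y) y, continuousOn_univ.2 (continuous_iff_continuousAt.2 ?_), ?_⟩
  · intro y
    rcases hk (h y) with ⟨z, hz, hfib, hkz⟩ | ⟨ho, hcont⟩
    · obtain rfl : y = z := by
        have : y ∈ h ⁻¹' {h y} := rfl
        rwa [hfib] at this
      have hle : ∀ᶠ z in 𝓝 y, h z ≤ h y :=
        hc.continuousAt.eventually ((isOpen_Iic_ordinal (h y)).mem_nhds self_mem_Iic)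
      have hlt : ∀ z, h z ≤ h y → z ≠ y → h z < h y := fun z hz hne => hz.lt_of_ne fun he =>
        hne (by
          have : z ∈ h ⁻¹' {h y} := he
          rwa [hfib] at this)
      have hval : M * h y + k (h y) y = M * h y := by rw [hkz, add_zero]
      refine tendsto_order.2 ⟨fun a ha => ?_, fun a ha => ?_⟩
      · dsimp only at ha
        rw [hval] at ha
        have hmul : Continuous fun a : Ordinal.{u} => M * a :=
          (Ordinal.isNormal_mul_right (zero_le.trans_lt (hM y))).continuous
        filter_upwards [(hmul.comp hc).continuousAt.eventually (lt_mem_nhds ha)] with z hz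
        exact hz.trans_le le_self_add
      · dsimp only at ha
        rw [hval] at ha
        filter_upwards [hle] with z hz
        by_cases hzy : z = y
        · rw [hzy, hval]
          exact ha
        · refine (hub z).trans_le (le_trans ?_ ha.le)
          gcongr
          exact Order.add_one_le_of_lt (hlt z hz hzy)
    · have hadd : Continuous fun a : Ordinal.{u} => M * h y + a :=
        (Ordinal.isNormal_add_right _).continuous
      have h1 : ContinuousAt (fun z => M * h y + k (h y) z) y :=
        hadd.continuousAt.comp (hcont.continuousAt (ho.mem_nhds rfl))
      refine h1.congr ?_
      filter_upwards [ho.mem_nhds (rfl : h y = h y)] with z hz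
      rw [show h z = h y from hz]
  · intro y _ z _ hyz
    dsimp only at hyz
    have key : ∀ y z, h y < h z → M * h y + k (h y) y < M * h z + k (h z) z := fun y z hlt =>
      (hub y).trans_le (le_trans (by gcongr; exact Order.add_one_le_of_lt hlt) le_self_add)
    rcases lt_trichotomy (h y) (h z) with hlt | heq | hlt
    · exact absurd hyz (key y z hlt).ne
    · rw [heq] at hyz
      exact hki (h z) heq rfl (by simpa using hyz)
    · exact absurd hyz (key z y hlt).ne'

/-- Gluing along an increasing family of clopen sets. -/
theorem injectsInOrdinal_of_filtration (C : Set Ordinal.{u}) (W : Ordinal.{u} → Set X)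
    (hW : ∀ a ∈ C, IsClopen (W a)) (mono : ∀ a ∈ C, ∀ b ∈ C, a ≤ b → W a ⊆ W b)
    (cover : ∀ y, ∃ a ∈ C, y ∈ W a)
    (hC : ∀ a ∈ C,
      ((∀ b < a, ∃ c ∈ C, b < c ∧ c < a) ∧ {y ∈ W a | ∀ b ∈ C, b < a → y ∉ W b}.Subsingleton) ∨
      (IsOpen {y | ∀ b ∈ C, b < a → y ∉ W b} ∧ InjectsInOrdinal (W a))) :
    InjectsInOrdinal (univ : Set X) := by
  -- The first index whose set contains `y`. It is locally constant where the earlier sets have open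
  -- joint complement; at the remaining indices its fibre is a single point.
  let h : X → Ordinal.{u} := fun y => sInf {a | a ∈ C ∧ y ∈ W a}
  have hmem : ∀ y, h y ∈ C ∧ y ∈ W (h y) := fun y =>
    csInf_mem (s := {a | a ∈ C ∧ y ∈ W a}) (cover y)
  have hle : ∀ y a, a ∈ C → y ∈ W a → h y ≤ a := fun y a ha hy => csInf_le' ⟨ha, hy⟩
  have hfib : ∀ y, h ⁻¹' {h y} = {z ∈ W (h y) | ∀ b ∈ C, b < h y → z ∉ W b} := fun y => by
    ext z
    refine ⟨fun hz => ?_, fun hz => ?_⟩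
    · obtain hz : h z = h y := hz
      rw [← hz]
      exact ⟨(hmem z).2, fun b hb hlt hzb => (hle z b hb hzb).not_gt hlt⟩
    · refine le_antisymm (hle z _ (hmem y).1 hz.1) (not_lt.1 fun hlt => ?_)
      exact hz.2 _ (hmem z).1 hlt (hmem z).2
  have hopen : ∀ y, IsOpen {z | ∀ b ∈ C, b < h y → z ∉ W b} → IsOpen (h ⁻¹' {h y}) :=
    fun y ho => by
      rw [hfib]
      exact (hW _ (hmem y).1).isOpen.inter ho
  refine injectsInOrdinal_of_fibres (h := h) (continuous_iff_continuousAt.2 fun y => ?_) fun y => ?_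
  · rcases hC (h y) (hmem y).1 with ⟨hlim, -⟩ | ⟨ho, -⟩
    · refine tendsto_order.2 ⟨fun a ha => ?_, fun a ha => ?_⟩
      · obtain ⟨c, hc, hac, hcy⟩ := hlim a ha
        have hyc : y ∉ W c := fun hy => (hle y c hc hy).not_gt hcy
        filter_upwards [(hW c hc).compl.isOpen.mem_nhds hyc] with z hz
        refine hac.trans (not_le.1 fun hzc => hz ?_)
        exact mono _ (hmem z).1 c hc hzc (hmem z).2
      · filter_upwards [(hW _ (hmem y).1).isOpen.mem_nhds (hmem y).2] with z hz
        exact (hle z _ (hmem y).1 hz).trans_lt ha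
    · refine (continuousAt_const (y := h y)).congr ?_
      filter_upwards [(hopen y ho).mem_nhds rfl] with z hz
      exact hz.symm
  · rcases hC (h y) (hmem y).1 with ⟨-, hsub⟩ | ⟨ho, hi⟩
    · left
      rw [← hfib] at hsub
      exact hsub.eq_singleton_of_mem rfl
    · right
      refine ⟨hopen y ho, hi.mono ?_⟩
      rw [hfib]
      exact fun z hz => hz.1

/-- A compact space that injects continuously into the ordinals is homeomorphic to an ordinal. -/
theorem exists_homeomorph_Iio [CompactSpace X] (hX : InjectsInOrdinal (univ : Set X)) :
    ∃ b : Ordinal.{u}, Nonempty (X ≃ₜ Iio b) := by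
  obtain ⟨k, hkc, hki⟩ := hX
  rw [continuousOn_univ] at hkc
  rw [injOn_univ] at hki
  -- Passing to the order type removes gaps in the image of `k`; rays still pull back to open sets.
  let r : X → X → Prop := fun x y => k x < k y
  let e : r ↪r ((· < ·) : Ordinal.{u} → Ordinal.{u} → Prop) := ⟨⟨k, hki⟩, Iff.rfl⟩
  have : IsWellOrder X r := e.isWellOrder
  let φ := (Ordinal.enum r).symm
  have hφ : ∀ x y, φ x < φ y ↔ k x < k y := fun x y => φ.map_rel_iff
  have hcont : Continuous φ := by
    refine OrderTopology.continuous_iff.2 fun a => ?_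
    obtain ⟨x, rfl⟩ := φ.surjective a
    have h1 : φ ⁻¹' Ioi (φ x) = k ⁻¹' Ioi (k x) := ext fun y => hφ x y
    have h2 : φ ⁻¹' Iio (φ x) = k ⁻¹' Iio (k x) := ext fun y => hφ y x
    rw [h1, h2]
    exact ⟨isOpen_Ioi.preimage hkc, isOpen_Iio.preimage hkc⟩
  exact ⟨Ordinal.type r, ⟨hcont.homeoOfEquivCompactToT2 (f := φ.toEquiv)⟩⟩

end

/-! ### Spaces whose subsets are separated by maps to the ordinals -/

/-- Along every subset of `X` some continuous map to the class of all ordinals cleaves. -/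
def CleavableOverOrdinals (X : Type u) [TopologicalSpace X] : Prop :=
  ∀ A : Set X, ∃ g : X → Ordinal.{u}, Continuous g ∧ ∀ a b, g a = g b → (a ∈ A ↔ b ∈ A)

theorem CleavableOver.cleavableOverOrdinals {X : Type u} [TopologicalSpace X] {l : Ordinal.{u}}
    (h : CleavableOver X (Iio l)) : CleavableOverOrdinals X := fun A => by
  obtain ⟨g, hg, hA⟩ := h A
  have key : ∀ a b, g a = g b → a ∈ A → b ∈ A := fun a b hab ha => by
    by_contra hb
    exact disjoint_left.1 hA ⟨a, ha, rfl⟩ ⟨b, hb, hab.symm⟩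
  refine ⟨fun x => g x, continuous_subtype_val.comp hg, fun a b hab => ?_⟩
  have hab : g a = g b := Subtype.ext hab
  exact ⟨key a b hab, key b a hab.symm⟩

theorem CleavableOverOrdinals.subtype {X : Type u} [TopologicalSpace X]
    (h : CleavableOverOrdinals X) (U : Set X) : CleavableOverOrdinals U := fun A => by
  obtain ⟨g, hg, hA⟩ := h (Subtype.val '' A)
  refine ⟨fun y => g y, hg.comp continuous_subtype_val, fun a b hab => ?_⟩
  simpa using hA a b hab

theorem CleavableOverOrdinals.t2Space {X : Type u} [TopologicalSpace X]
    (h : CleavableOverOrdinals X) : T2Space X := by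
  refine ⟨fun x y hxy => ?_⟩
  obtain ⟨g, hg, hA⟩ := h {x}
  exact separated_by_continuous hg fun hgxy => hxy ((hA x y hgxy).1 rfl).symm

/-- `f` is a continuous map to the ordinals that has a strict maximum at `x`. -/
structure IsPeak {X : Type u} [TopologicalSpace X] (f : X → Ordinal.{u}) (x : X) : Prop where
  continuous : Continuous f
  pos : 0 < f x
  le : ∀ y, f y ≤ f x
  eq : ∀ y, f y = f x → y = x

section

variable {X : Type u} [TopologicalSpace X]

/-- A map cleaving along `{x}` takes its value at `x` only there. Points with larger values form a
clopen set and are sent to `0`; the shift `1 +` keeps the value at `x` above `0` and is continuous.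
-/
theorem CleavableOverOrdinals.exists_isPeak (h : CleavableOverOrdinals X) (x : X) :
    ∃ f, IsPeak f x := by
  classical
  obtain ⟨g, hg, hA⟩ := h {x}
  have hadd : Continuous fun a : Ordinal.{u} => 1 + a := (Ordinal.isNormal_add_right 1).continuous
  have hpos : ∀ a : Ordinal.{u}, 0 < 1 + a := fun a => zero_lt_one.trans_le le_self_add
  have hx : (if g x ≤ g x then 1 + g x else 0) = 1 + g x := if_pos le_rfl
  refine ⟨fun y => if g y ≤ g x then 1 + g y else 0, ?_, ?_, fun y => ?_, fun y hy => ?_⟩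
  · have hclopen : IsClopen {y | g y ≤ g x} :=
      ⟨isClosed_Iic.preimage hg, (isOpen_Iic_ordinal _).preimage hg⟩
    refine Continuous.if (fun a ha => ?_) (hadd.comp hg) continuous_const
    rw [hclopen.frontier_eq] at ha
    exact ha.elim
  · exact (hpos (g x)).trans_eq hx.symm
  · rw [hx]
    split_ifs with hy
    · gcongr
    · exact zero_le
  · rw [hx] at hy
    split_ifs at hy with hle
    · exact (hA x y (by simpa using hy.symm)).1 rfl
    · exact absurd hy (hpos (g x)).ne

theorem IsPeak.lt {f : X → Ordinal.{u}} {x : X} (hf : IsPeak f x) {y : X} (hy : y ≠ x) :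
    f y < f x :=
  (hf.le y).lt_of_ne fun h => hy (hf.eq y h)

theorem IsPeak.exists_subset [CompactSpace X] {f : X → Ordinal.{u}} {x : X} (hf : IsPeak f x)
    {O : Set X} (hO : O ∈ 𝓝 x) : ∃ b < f x, ∀ y, b < f y → y ∈ O := by
  have hK : IsCompact (interior O)ᶜ := isOpen_interior.isClosed_compl.isCompact
  rcases (interior O)ᶜ.eq_empty_or_nonempty with he | hne
  · refine ⟨0, hf.pos, fun y _ => interior_subset ?_⟩
    rw [compl_empty_iff.1 he]
    trivial
  · obtain ⟨z, hz, hmax⟩ := hK.exists_isMaxOn hne hf.continuous.continuousOn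
    refine ⟨f z, hf.lt ?_, fun y hy => interior_subset (by_contra fun h => hy.not_ge (hmax h))⟩
    rintro rfl
    exact hz (mem_interior_iff_mem_nhds.2 hO)

/-- Where `f` takes values in `Y` arbitrarily close to `a` from below, the value `a` is taken at a
point of `Y` in the closure of `{f < a}`. -/
theorem exists_mem_closure_of_cofinal [CompactSpace X] {f : X → Ordinal.{u}} (hf : Continuous f)
    {Y : Set X} (hY : IsClosed Y) {a : Ordinal.{u}} (h0 : 0 < a)
    (h : ∀ b < a, ∃ y ∈ Y, b < f y ∧ f y < a) :
    ∃ y ∈ Y, y ∈ closure {z | f z < a} ∧ f y = a := by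
  obtain ⟨z, hz, -, hza⟩ := h 0 h0
  -- A maximum of `f` on this closure cannot be below `a`, since larger values below `a` occur.
  have hK : IsCompact (closure (Y ∩ {z | f z < a})) := isClosed_closure.isCompact
  obtain ⟨y, hy, hmax⟩ := hK.exists_isMaxOn ⟨z, subset_closure ⟨hz, hza⟩⟩ hf.continuousOn
  refine ⟨y, closure_minimal inter_subset_left hY hy, closure_mono inter_subset_right hy, ?_⟩
  have hle : f y ≤ a :=
    closure_minimal (fun z hz => le_of_lt hz.2) (isClosed_Iic.preimage hf) hy
  refine hle.eq_of_not_lt fun hlt => ?_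
  obtain ⟨w, hw, hyw, hwa⟩ := h _ hlt
  exact hyw.not_ge (hmax (subset_closure ⟨hw, hwa⟩))

end

/-! ### Isolated points -/

/-- A tree of nested subsets of `Q`: the children of `U` are the fibres in `U` of the map
`p (sel U)` over the isolated points of its image other than its value at `sel U`. -/
inductive PeakTree {X : Type u} (Q : Set X) (p : X → X → Ordinal.{u}) (sel : Set X → X) :
    ℕ → Set X → Prop
  | root : PeakTree Q p sel 0 Q
  | child {n : ℕ} {U : Set X} (hU : PeakTree Q p sel n U) (a b : Ordinal.{u}) (hba : b < a)
      (ha : a < p (sel U) (sel U)) (hne : (U ∩ {y | p (sel U) y = a}).Nonempty)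
      (hb : ∀ z ∈ U, b < p (sel U) z → a ≤ p (sel U) z) :
      PeakTree Q p sel (n + 1) (U ∩ {y | p (sel U) y = a})

section

variable {X : Type u} {Q : Set X} {p : X → X → Ordinal.{u}} {sel : Set X → X}

theorem PeakTree.nonempty (hQ : Q.Nonempty) {n : ℕ} {U : Set X} (hU : PeakTree Q p sel n U) :
    U.Nonempty := by
  cases hU with
  | root => exact hQ
  | child _ _ _ _ _ hne _ => exact hne

/-- No value on `U` lies strictly between `b` and `a`, so the fibre over `a` is cut out by the open
interval `(b, a]`. -/
theorem PeakTree.exists_isOpen [TopologicalSpace X] (hp : ∀ x, Continuous (p x)) {n : ℕ} {U : Set X}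
    (hU : PeakTree Q p sel n U) : ∃ O, IsOpen O ∧ U = Q ∩ O := by
  induction hU with
  | root => exact ⟨univ, isOpen_univ, (inter_univ Q).symm⟩
  | @child n U _ a b hba _ _ hb ih =>
    obtain ⟨O, hO, rfl⟩ := ih
    refine ⟨O ∩ p (sel (Q ∩ O)) ⁻¹' (Ioi b ∩ Iic a),
      hO.inter ((isOpen_Ioi.inter (isOpen_Iic_ordinal a)).preimage (hp _)), ?_⟩
    ext y
    constructor
    · rintro ⟨⟨hyQ, hyO⟩, hy : p (sel (Q ∩ O)) y = a⟩
      exact ⟨hyQ, hyO, hba.trans_eq hy.symm, hy.le⟩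
    · rintro ⟨hyQ, hyO, hby, hya⟩
      exact ⟨⟨hyQ, hyO⟩, le_antisymm hya (hb y ⟨hyQ, hyO⟩ hby)⟩

theorem PeakTree.eq_of_mem {n : ℕ} {U V : Set X} (hU : PeakTree Q p sel n U)
    (hV : PeakTree Q p sel n V) {y : X} (hyU : y ∈ U) (hyV : y ∈ V) : U = V := by
  induction n generalizing U V with
  | zero =>
    cases hU
    cases hV
    rfl
  | succ n ih =>
    cases hU with
    | child hU a _ _ _ _ _ =>
      cases hV with
      | child hV a' _ _ _ _ _ =>
        obtain rfl := ih hU hV hyU.1 hyV.1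
        obtain rfl : a = a' := hyU.2.symm.trans hyV.2
        rfl

theorem PeakTree.exists_ancestor {n m : ℕ} (hnm : n < m) {U : Set X} (hU : PeakTree Q p sel m U) :
    ∃ V, PeakTree Q p sel n V ∧ U ⊆ V ∧ sel V ∉ U := by
  induction hU with
  | root => omega
  | @child m V hV a b _ ha _ _ ih =>
    rcases (Nat.lt_succ_iff.1 hnm).eq_or_lt with rfl | hlt
    · exact ⟨V, hV, inter_subset_left, fun h => ha.ne' h.2⟩
    · obtain ⟨V', hV', hsub, hsel⟩ := ih hlt
      exact ⟨V', hV', inter_subset_left.trans hsub, fun h => hsel h.1⟩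

/-- A point is selected on one level only, as the selected point of a node lies in none of its
proper descendants. So levels can be two-coloured by parity. -/
theorem PeakTree.level_le (hQ : Q.Nonempty) (hsel : ∀ U : Set X, U.Nonempty → sel U ∈ U)
    {n m : ℕ} {U V : Set X} (hU : PeakTree Q p sel n U) (hV : PeakTree Q p sel m V)
    (h : sel U = sel V) : m ≤ n := by
  by_contra! hlt
  obtain ⟨U', hU', hsub, hnot⟩ := hV.exists_ancestor hlt
  have hVm := hsel V (hV.nonempty hQ)
  obtain rfl := hU.eq_of_mem hU' (hsel U (hU.nonempty hQ)) (h ▸ hsub hVm)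
  exact hnot (h ▸ hVm)

theorem PeakTree.exists_child [TopologicalSpace X] [CompactSpace X] (hp : ∀ x, IsPeak (p x) x)
    (hQ : Q.Nonempty)
    (hsel : ∀ U : Set X, U.Nonempty → sel U ∈ U)
    (hcrowded : ∀ x ∈ Q, ∀ O ∈ 𝓝 x, ∃ y ∈ O, y ∈ Q ∧ y ≠ x)
    {n : ℕ} {U : Set X} (hU : PeakTree Q p sel n U) {O : Set X} (hO : O ∈ 𝓝 (sel U)) :
    ∃ V, PeakTree Q p sel (n + 1) V ∧ sel V ∈ O := by
  have hmem := hsel U (hU.nonempty hQ)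
  obtain ⟨b, hb, hbO⟩ := (hp (sel U)).exists_subset hO
  obtain ⟨O', hO', hUO⟩ := hU.exists_isOpen fun x => (hp x).continuous
  have hmem' : sel U ∈ Q ∩ O' := hUO ▸ hmem
  obtain ⟨y, ⟨hyO, hyb⟩, hyQ, hyne⟩ := hcrowded (sel U) hmem'.1
    (O' ∩ p (sel U) ⁻¹' Ioi b)
    (inter_mem (hO'.mem_nhds hmem'.2) ((isOpen_Ioi.preimage (hp _).continuous).mem_nhds hb))
  have hyU : y ∈ U := hUO ▸ ⟨hyQ, hyO⟩
  -- The least value above `b` is isolated from below in the image of `U`, and its fibre lies in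
  -- `O`.
  let S := {a | ∃ z ∈ U, b < p (sel U) z ∧ p (sel U) z = a}
  have hyS : p (sel U) y ∈ S := ⟨y, hyU, hyb, rfl⟩
  obtain ⟨z, hz, hbz, hza⟩ : sInf S ∈ S := csInf_mem ⟨_, hyS⟩
  have hne : (U ∩ {y | p (sel U) y = sInf S}).Nonempty := ⟨z, hz, hza⟩
  refine ⟨_, hU.child (sInf S) b (hza ▸ hbz) ((csInf_le' hyS).trans_lt ((hp _).lt hyne)) hne
    fun w hw hbw => csInf_le' ⟨w, hw, hbw, rfl⟩, hbO _ ?_⟩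
  rw [(hsel _ hne).2, ← hza]
  exact hbz

end

/-- Every nonempty subset of a compact space cleavable over the ordinals has an isolated point. -/
theorem CleavableOverOrdinals.exists_isolated {X : Type u} [TopologicalSpace X] [CompactSpace X]
    (h : CleavableOverOrdinals X) {Q : Set X} (hQ : Q.Nonempty) :
    ∃ x ∈ Q, ∃ O ∈ 𝓝 x, ∀ y ∈ O, y ∈ Q → y = x := by
  by_contra! hcrowded
  choose p hp using h.exists_isPeak
  have : Nonempty X := ⟨hQ.some⟩
  let sel : Set X → X := fun U => Classical.epsilon (· ∈ U)
  have hsel : ∀ U : Set X, U.Nonempty → sel U ∈ U := fun U hU => Classical.epsilon_spec hU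
  -- Minimise `g` over all selected points. Some child selects a point so near that `g` does not
  -- increase, hence stays equal, although the parity of the level changes.
  obtain ⟨g, hg, hgA⟩ := h {x | ∃ n U, PeakTree Q p sel n U ∧ Even n ∧ sel U = x}
  let S := {a | ∃ n U, PeakTree Q p sel n U ∧ g (sel U) = a}
  obtain ⟨n, U, hU, hUa⟩ : sInf S ∈ S := csInf_mem ⟨_, 0, Q, .root, rfl⟩
  obtain ⟨V, hV, hVU⟩ := hU.exists_child hp hQ hsel hcrowded
    (((isOpen_Iic_ordinal _).preimage hg).mem_nhds (self_mem_Iic : g (sel U) ∈ Iic (g (sel U))))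
  have heq : g (sel U) = g (sel V) :=
    le_antisymm (hUa.trans_le (csInf_le' ⟨_, V, hV, rfl⟩)) hVU
  have hpar : ∀ {m W}, PeakTree Q p sel m W →
      (sel W ∈ {x | ∃ n U, PeakTree Q p sel n U ∧ Even n ∧ sel U = x} ↔ Even m) := by
    intro m W hW
    refine ⟨?_, fun hm => ⟨m, W, hW, hm, rfl⟩⟩
    rintro ⟨k, W', hW', hk, hsW⟩
    rwa [le_antisymm (hW'.level_le hQ hsel hW hsW) (hW.level_le hQ hsel hW' hsW.symm)]
  have := hgA _ _ heq
  rw [hpar hU, hpar hV, Nat.even_add_one] at this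
  tauto

/-! ### Embedding a neighbourhood of a point whose complements embed -/

section

variable {X : Type u} [TopologicalSpace X] {f : X → Ordinal.{u}} {x : X}

/-- Cleaving along a set that contains, of the chosen points `c a`, exactly those with `a ∈ T`, and
all other points except `x`, shows that `c a` is, for `a ∉ T` in a club, the only point of
`{f ≥ a}` near the boundary of `{f < a}`. -/
theorem exists_clubBelow_isClopen [CompactSpace X]
    (hX : CleavableOverOrdinals X) (hf : IsPeak f x)
    (hx : ∀ b < f x, ∃ y, b < f y ∧ f y < f x) (ho : UncountableCofinality (f x))
    (c : Ordinal.{u} → X)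
    (hc : ∀ a, (∃ y ∈ closure {z | f z < a}, f y = a) → c a ∈ closure {z | f z < a} ∧ f (c a) = a)
    (T : Set Ordinal.{u}) (hT : ∀ C, ClubBelow (f x) C → ∃ a ∈ C, a ∈ T) :
    ∃ C, ClubBelow (f x) C ∧
      ∀ a ∈ C, f (c a) = a ∧ (a ∉ T → IsClopen ({y | f y < a} ∪ {c a})) := by
  obtain ⟨g, hg, hgA⟩ := hX {y | y ≠ x ∧ ¬ (f y ∉ T ∧ y = c (f y))}
  have hgx : ∀ y, g y = g x → y = x ∨ f y ∉ T ∧ y = c (f y) := fun y hy => by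
    by_contra! h
    exact ((hgA y x hy).1 ⟨h.1, fun h' => h.2 h'.1 h'.2⟩).1 rfl
  obtain ⟨b₀, hb₀, hle⟩ := hf.exists_subset
    (((isOpen_Iic_ordinal _).preimage hg).mem_nhds (self_mem_Iic : g x ∈ Iic (g x)))
  -- Otherwise `{g ≥ g x}` would reach levels cofinal in some `a ∈ T`, giving a point of level `a`
  -- where `g` equals `g x`; over `T` there is none.
  obtain ⟨b₁, hb₁, hlt⟩ : ∃ b₁ < f x, ∀ y, b₁ < f y → y ≠ x → g y < g x := by
    by_contra! hcon
    obtain ⟨a, ⟨hao, ha0, ha⟩, haT⟩ := hT _ (clubBelow_closure ho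
      (fun b d => b₀ < d ∧ ∃ y, g x ≤ g y ∧ b < f y ∧ f y ≤ d)
      (fun b b' d hb h => ⟨h.1, h.2.imp fun y hy => ⟨hy.1, hb.trans_lt hy.2.1, hy.2.2⟩⟩)
      (fun b hb => by
        obtain ⟨y, hy, hyx, hgy⟩ := hcon (max b b₀) (max_lt hb hb₀)
        exact ⟨f y, hf.lt hyx, (le_max_right _ _).trans_lt hy, y, hgy,
          (le_max_left _ _).trans_lt hy, le_rfl⟩))
    obtain ⟨y, hyZ, -, rfl⟩ := exists_mem_closure_of_cofinal hf.continuous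
      (isClosed_Ici.preimage hg : IsClosed (g ⁻¹' Ici (g x))) ha0 (fun b hb => by
        obtain ⟨d, hd, -, y, hy, hby, hyd⟩ := ha b hb
        exact ⟨y, hy, hby, hyd.trans_lt hd⟩)
    obtain ⟨d, hd, hb₀d, -⟩ := ha 0 ha0
    rcases hgx y (le_antisymm (hle y (hb₀d.trans hd)) hyZ) with rfl | h
    · exact hao.false
    · exact h.1 haT
  -- Levels `a` such that each point `y` with `b₁ < f y < a` has a bound below `a` on the levels
  -- where `g ≤ g y`.
  refine ⟨_, clubBelow_closure ho (fun b d => b₁ < d ∧ (∃ y, b < f y ∧ f y ≤ d) ∧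
      ∀ y y', b₁ < f y → f y ≤ b → g y' ≤ g y → f y' ≤ d)
    (fun b b' d hb h => ⟨h.1, h.2.1.imp fun y hy => ⟨hb.trans_lt hy.1, hy.2⟩,
      fun y y' h1 h2 => h.2.2 y y' h1 (h2.trans hb)⟩) (fun b hb => ?_), ?_⟩
  · obtain ⟨y₁, hy₁, hy₁x⟩ := hx b hb
    obtain ⟨e, he, hbd⟩ : ∃ e < f x, ∀ y y', b₁ < f y → f y ≤ b → g y' ≤ g y → f y' ≤ e := by
      have hK : IsCompact (f ⁻¹' (Ioi b₁ ∩ Iic b)) :=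
        (((isClosed_Ioi_ordinal b₁).inter isClosed_Iic).preimage hf.continuous).isCompact
      rcases (f ⁻¹' (Ioi b₁ ∩ Iic b)).eq_empty_or_nonempty with hem | hne
      · exact ⟨0, hf.pos, fun y y' h1 h2 _ =>
          ((eq_empty_iff_forall_notMem.1 hem y) ⟨h1, h2⟩).elim⟩
      · obtain ⟨y₀, hy₀, hmax⟩ := hK.exists_isMaxOn hne hg.continuousOn
        have hy₀x : y₀ ≠ x := by
          rintro rfl
          exact hb.not_ge hy₀.2
        obtain ⟨e, he, heg⟩ := hf.exists_subset
          ((isOpen_Ioi.preimage hg).mem_nhds (hlt y₀ hy₀.1 hy₀x : g x ∈ Ioi (g y₀)))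
        refine ⟨e, he, fun y y' h1 h2 hyy => not_lt.1 fun hlt' => ?_⟩
        have hle' : g y ≤ g y₀ := hmax (show y ∈ f ⁻¹' (Ioi b₁ ∩ Iic b) from ⟨h1, h2⟩)
        exact (heg y' hlt').not_ge (hyy.trans hle')
    refine ⟨max (b₁ + 1) (max (f y₁) e), max_lt (ho.add_one_lt _ hb₁) (max_lt hy₁x he),
      (lt_add_one b₁).trans_le (le_max_left _ _),
      ⟨y₁, hy₁, (le_max_left _ _).trans (le_max_right _ _)⟩, fun y y' h1 h2 h3 =>
        (hbd y y' h1 h2 h3).trans ((le_max_right _ _).trans (le_max_right _ _))⟩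
  · rintro a ⟨hao, ha0, ha⟩
    obtain ⟨hca, hfc⟩ := hc a (by
      obtain ⟨y, -, hy⟩ := exists_mem_closure_of_cofinal hf.continuous isClosed_univ ha0
        (fun b hb => by
          obtain ⟨d, hd, -, ⟨y, hby, hyd⟩, -⟩ := ha b hb
          exact ⟨y, trivial, hby, hyd.trans_lt hd⟩)
      exact ⟨y, hy⟩)
    have hb₁a : b₁ < a := by
      obtain ⟨d, hd, hb₁d, -⟩ := ha 0 ha0
      exact hb₁d.trans hd
    -- All boundary points of level `a` thus share the least value of `g` on `{f ≥ a}`; for `a ∉ T`,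
    -- cleaving leaves only `c a` with that value on its level.
    have key : ∀ y ∈ closure {z | f z < a}, f y = a → ∀ z, a ≤ f z → g y ≤ g z := by
      intro y hy hya z hz
      by_contra! hzy
      obtain ⟨w, ⟨hw1, hw2⟩, hwa⟩ := mem_closure_iff.1 hy (g ⁻¹' Ioi (g z) ∩ f ⁻¹' Ioi b₁)
        ((isOpen_Ioi.preimage hg).inter (isOpen_Ioi.preimage hf.continuous))
        ⟨hzy, hb₁a.trans_eq hya.symm⟩
      obtain ⟨d, hd, -, -, h⟩ := ha (f w) hwa
      exact (hz.trans (h w z hw2 le_rfl (le_of_lt hw1))).not_gt hd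
    refine ⟨hfc, fun haT => ?_⟩
    have hne : ∀ y, f y = a → y ≠ c a → g (c a) < g y := fun y hya hyc => by
      refine (key _ hca hfc y hya.ge).lt_of_ne fun heq => ?_
      refine ((hgA _ _ heq).2 ⟨?_, ?_⟩).2 ⟨by rwa [hfc], by rw [hfc]⟩
      · rintro rfl
        exact hao.ne' hya
      · rintro ⟨-, h⟩
        rw [hya] at h
        exact hyc h
    constructor
    · refine isClosed_of_closure_subset fun y hy => ?_
      rw [closure_union] at hy
      have hy' : y ∈ closure {z | f z < a} := hy.elim id fun h =>
        closure_minimal (singleton_subset_iff.2 hca) isClosed_closure h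
      have hya : f y ≤ a :=
        closure_minimal (fun z hz => le_of_lt hz) (isClosed_Iic.preimage hf.continuous) hy'
      rcases hya.lt_or_eq with h | h
      · exact Or.inl h
      · by_contra hcon
        exact (hne y h fun h' => hcon (Or.inr h')).not_ge (key y hy' h _ hfc.ge)
    · have : ({y | f y < a} ∪ {c a} : Set X) =
          {y | f y < a} ∪ f ⁻¹' Iic a ∩ g ⁻¹' Iic (g (c a)) := by
        ext y
        refine or_congr_right' fun hy => ⟨?_, fun h => ?_⟩
        · rintro rfl
          exact ⟨hfc.le, le_refl (g (c a))⟩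
        · by_contra hyc
          exact (hne y (le_antisymm h.1 (not_lt.1 hy)) hyc).not_ge h.2
      rw [this]
      exact (isOpen_Iio.preimage hf.continuous).union
        (((isOpen_Iic_ordinal a).preimage hf.continuous).inter ((isOpen_Iic_ordinal _).preimage hg))

/-- A level set of `f` at a limit may have many points, so the filtration uses `{f < a} ∪ {c a}`,
which gains only `c a` there. -/
theorem injectsInOrdinal_of_uncountableCofinality [CompactSpace X]
    (hX : CleavableOverOrdinals X) (hf : IsPeak f x)
    (hx : ∀ b < f x, ∃ y, b < f y ∧ f y < f x) (ho : UncountableCofinality (f x))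
    (hK : ∀ K : Set X, IsClosed K → x ∉ K → InjectsInOrdinal K) :
    InjectsInOrdinal (univ : Set X) := by
  obtain ⟨T, hT⟩ := exists_bistationary ho hf.pos
  have hc : ∀ a, ∃ p, (∃ y ∈ closure {z | f z < a}, f y = a) →
      p ∈ closure {z | f z < a} ∧ f p = a := fun a => by
    by_cases h : ∃ y ∈ closure {z | f z < a}, f y = a
    · exact h.imp fun y hy _ => hy
    · exact ⟨x, fun h' => (h h').elim⟩
  choose c hc using hc
  have hcx : c (f x) = x := by
    obtain ⟨y, -, hy⟩ := exists_mem_closure_of_cofinal hf.continuous isClosed_univ hf.pos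
      (fun b hb => (hx b hb).imp fun y hy => ⟨trivial, hy⟩)
    exact hf.eq _ (hc _ ⟨y, hy⟩).2
  obtain ⟨C₁, hC₁, h₁⟩ := exists_clubBelow_isClopen hX hf hx ho c hc T fun C hC => (hT C hC).1
  obtain ⟨C₂, hC₂, h₂⟩ := exists_clubBelow_isClopen hX hf hx ho c hc Tᶜ fun C hC => (hT C hC).2
  have hC := hC₁.inter ho hC₂
  have huniv : ({y | f y < f x} ∪ {c (f x)} : Set X) = univ := by
    rw [hcx]
    exact eq_univ_of_forall fun y => (eq_or_ne y x).symm.imp (fun h => hf.lt h) id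
  have hfc : ∀ a ∈ insert (f x) (C₁ ∩ C₂), f (c a) = a := by
    rintro a (rfl | ha)
    · rw [hcx]
    · exact (h₁ a ha.1).1
  have hclopen : ∀ a ∈ insert (f x) (C₁ ∩ C₂), IsClopen ({y | f y < a} ∪ {c a}) := by
    rintro a (rfl | ha)
    · rw [huniv]
      exact isClopen_univ
    · by_cases haT : a ∈ T
      · exact (h₂ a ha.2).2 fun h => h haT
      · exact (h₁ a ha.1).2 haT
  have hmono : ∀ a ∈ insert (f x) (C₁ ∩ C₂), ∀ b ∈ insert (f x) (C₁ ∩ C₂), a ≤ b →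
      ({y | f y < a} ∪ {c a} : Set X) ⊆ {y | f y < b} ∪ {c b} := by
    rintro a ha b - hab y hy
    rcases hab.eq_or_lt with rfl | hlt
    · exact hy
    · rcases hy with hy | rfl
      · exact Or.inl (lt_trans hy hlt)
      · exact Or.inl ((hfc a ha).trans_lt hlt)
  refine injectsInOrdinal_of_filtration (insert (f x) (C₁ ∩ C₂)) (fun a => {y | f y < a} ∪ {c a})
    hclopen hmono (fun y => ⟨f x, mem_insert _ _, huniv ▸ mem_univ y⟩) fun a ha => ?_
  by_cases hlim : ∀ b < a, ∃ d ∈ insert (f x) (C₁ ∩ C₂), b < d ∧ d < a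
  · refine Or.inl ⟨hlim, subsingleton_of_forall_eq (c a) fun y hy => ?_⟩
    rcases hy.1 with hya | h
    · obtain ⟨d, hd, hyd, hda⟩ := hlim _ hya
      exact (hy.2 d hd hda (Or.inl hyd)).elim
    · exact h
  · right
    have hao : a < f x := by
      rcases ha with rfl | ha
      · refine (hlim fun b hb => ?_).elim
        obtain ⟨d, hd, hbd⟩ := hC.unbounded b hb
        exact ⟨d, Or.inr hd, hbd, hC.lt d hd⟩
      · exact hC.lt a ha
    refine ⟨?_, hK _ (hclopen a ha).isClosed ?_⟩
    · have hmem : ∀ d ∈ insert (f x) (C₁ ∩ C₂), d < a → d ∈ C₁ ∩ C₂ := fun d hd hda =>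
        hd.resolve_left fun h => (h ▸ hda).not_gt hao
      rcases hC.exists_max hao (fun h => hlim fun b hb =>
        (h b hb).imp fun d hd => ⟨Or.inr hd.1, hd.2⟩) with hem | ⟨d, hd, hda, hmax⟩
      · convert isOpen_univ
        exact eq_univ_of_forall fun y b hb hba => (hem b (hmem b hb hba) hba).elim
      · convert (hclopen d (Or.inr hd)).compl.isOpen using 1
        ext y
        refine ⟨fun h => h d (Or.inr hd) hda, fun h b hb hba hy => h ?_⟩
        exact hmono b hb d (Or.inr hd) (hmax b (hmem b hb hba) hba) hy
    · rintro (h | h)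
      · exact hao.not_gt h
      · exact hao.ne' (by rw [← hfc a ha, ← show x = c a from h])

theorem injectsInOrdinal_of_countableCofinality (hf : IsPeak f x)
    (s : ℕ → Ordinal.{u}) (hs : ∀ n, s n < f x) (hcof : ∀ b < f x, ∃ n, b < s n)
    (hK : ∀ K : Set X, IsClosed K → x ∉ K → InjectsInOrdinal K) :
    InjectsInOrdinal (univ : Set X) := by
  let t : ℕ → Ordinal.{u} := fun n => partialSups s n
  have ht : ∀ n, t n < f x := fun n => by
    obtain ⟨m, -, hm⟩ := exists_partialSups_eq s n
    exact hm.trans_lt (hs m)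
  have hst : ∀ n, s n ≤ t n := le_partialSups s
  have htm : Monotone t := (partialSups s).monotone
  refine injectsInOrdinal_of_filtration (insert (f x) (range t)) (fun a => f ⁻¹' Iic a)
    (fun a _ => ⟨isClosed_Iic.preimage hf.continuous,
      (isOpen_Iic_ordinal a).preimage hf.continuous⟩)
    (fun a _ b _ hab y hy => le_trans hy hab) (fun y => ⟨f x, mem_insert _ _, hf.le y⟩) ?_
  rintro a (rfl | ⟨n, rfl⟩)
  · refine Or.inl ⟨fun b hb => ?_, subsingleton_of_forall_eq x fun y hy => ?_⟩
    · obtain ⟨n, hn⟩ := hcof b hb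
      exact ⟨t n, Or.inr ⟨n, rfl⟩, hn.trans_le (hst n), ht n⟩
    · by_contra hyx
      obtain ⟨n, hn⟩ := hcof _ (hf.lt hyx)
      exact hy.2 (t n) (Or.inr ⟨n, rfl⟩) (ht n) (hn.le.trans (hst n))
  · refine Or.inr ⟨?_, hK _ (isClosed_Iic.preimage hf.continuous) fun h => (ht n).not_ge h⟩
    -- Only finitely many indices precede `t n`, so the joint complement of the earlier sets is
    -- open.
    have hfin : {b | b ∈ insert (f x) (range t) ∧ b < t n}.Finite := by
      refine ((finite_Iio n).image t).subset ?_
      rintro b ⟨rfl | ⟨m, rfl⟩, hb⟩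
      · exact absurd hb (ht n).not_gt
      · exact ⟨m, htm.reflect_lt hb, rfl⟩
    convert hfin.isOpen_biInter (f := fun b => f ⁻¹' Ioi b)
      (fun b _ => isOpen_Ioi.preimage hf.continuous) using 1
    ext y
    simp only [mem_ofPred_eq, mem_preimage, mem_Iic, mem_iInter, mem_Ioi, not_le, and_imp]

/-- A compact space cleavable over the ordinals embeds in the ordinals if all its closed subsets
missing a certain point do. -/
theorem CleavableOverOrdinals.injectsInOrdinal_of_forall_notMem [CompactSpace X]
    (hX : CleavableOverOrdinals X)
    (x : X) (hK : ∀ K : Set X, IsClosed K → x ∉ K → InjectsInOrdinal K) :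
    InjectsInOrdinal (univ : Set X) := by
  have := hX.t2Space
  obtain ⟨f, hf⟩ := hX.exists_isPeak x
  by_cases hx : ∀ b < f x, ∃ y, b < f y ∧ f y < f x
  · by_cases hb : ∀ s : ℕ → Ordinal.{u}, (∀ n, s n < f x) → ∃ c < f x, ∀ n, s n ≤ c
    · refine injectsInOrdinal_of_uncountableCofinality hX hf hx ⟨fun b hbx => ?_, hb⟩ hK
      obtain ⟨y, hby, hyx⟩ := hx b hbx
      exact (Order.add_one_le_of_lt hby).trans_lt hyx
    · push Not at hb
      obtain ⟨s, hs, hcof⟩ := hb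
      exact injectsInOrdinal_of_countableCofinality hf s hs hcof hK
  · push Not at hx
    obtain ⟨b, hb, hbx⟩ := hx
    have hopen : IsOpen {x} := by
      convert isOpen_Ioi.preimage hf.continuous (t := Ioi b)
      ext y
      refine ⟨?_, fun hy => hf.eq y (le_antisymm (hf.le y) (hbx y hy))⟩
      rintro rfl
      exact hb
    rw [← union_compl_self {x}]
    exact InjectsInOrdinal.union ⟨fun _ => 0, continuousOn_const, injOn_singleton _ _⟩
      (hK _ hopen.isClosed_compl fun h => h rfl) ⟨isClosed_singleton, hopen⟩

/-- A compact space cleavable over the ordinals embeds in the ordinals. -/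
theorem CleavableOverOrdinals.injectsInOrdinal_univ [CompactSpace X]
    (hX : CleavableOverOrdinals X) :
    InjectsInOrdinal (univ : Set X) := by
  have := hX.t2Space
  let G : Set X := {y | ∃ U, IsClopen U ∧ y ∈ U ∧ InjectsInOrdinal U}
  have hG : ∀ K : Set X, IsCompact K → K ⊆ G → InjectsInOrdinal K := by
    intro K hK hKG
    obtain ⟨U, -, hKU, hU⟩ : ∃ U, IsClopen U ∧ K ⊆ U ∧ InjectsInOrdinal U := by
      refine hK.induction_on (p := fun K => ∃ U, IsClopen U ∧ K ⊆ U ∧ InjectsInOrdinal U)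
        ?_ ?_ ?_ ?_
      · exact ⟨∅, isClopen_empty, Subset.rfl, fun _ => 0, continuousOn_empty _, injOn_empty _⟩
      · rintro S T hST ⟨U, hU, hTU, hi⟩
        exact ⟨U, hU, hST.trans hTU, hi⟩
      · rintro S T ⟨U, hU, hSU, hi⟩ ⟨V, hV, hTV, hj⟩
        exact ⟨U ∪ V, hU.union hV, union_subset_union hSU hTV, hi.union hj hU⟩
      · intro y hy
        obtain ⟨U, hU, hyU, hi⟩ := hKG hy
        exact ⟨U, mem_nhdsWithin_of_mem_nhds (hU.isOpen.mem_nhds hyU), U, hU, Subset.rfl, hi⟩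
    exact hU.mono hKU
  refine hG univ isCompact_univ fun z _ => by_contra fun hz => ?_
  obtain ⟨x, hxG, O, hO, hOx⟩ := hX.exists_isolated (Q := Gᶜ) ⟨z, hz⟩
  obtain ⟨f, hf⟩ := hX.exists_isPeak x
  obtain ⟨b, hb, hbO⟩ := hf.exists_subset hO
  -- Apart from `x`, `U` lies in `G`, so its closed subsets missing `x` inject by compactness; the
  -- local step then puts `x` into `G`.
  let U : Set X := f ⁻¹' Ioi b
  have hU : IsClopen U :=
    ⟨(isClosed_Ioi_ordinal b).preimage hf.continuous, isOpen_Ioi.preimage hf.continuous⟩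
  have : CompactSpace U := isCompact_iff_compactSpace.1 hU.isClosed.isCompact
  obtain ⟨k, hkc, hki⟩ := (hX.subtype U).injectsInOrdinal_of_forall_notMem ⟨x, hb⟩ fun K hK hxK => by
    obtain ⟨m, hmc, hmi⟩ := hG (Subtype.val '' K) (hK.isCompact.image continuous_subtype_val) (by
      rintro _ ⟨y, hy, rfl⟩
      by_contra hyG
      refine hxK ?_
      convert hy
      exact Subtype.ext (hOx y (hbO y y.2) hyG).symm)
    exact ⟨fun y => m y, hmc.comp continuous_subtype_val.continuousOn fun y hy => ⟨y, hy, rfl⟩,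
      fun y hy z hz h => Subtype.ext (hmi ⟨y, hy, rfl⟩ ⟨z, hz, rfl⟩ h)⟩
  classical
  refine hxG ⟨U, hU, hb, fun y => if h : y ∈ U then k ⟨y, h⟩ else 0, ?_, ?_⟩
  · rw [continuousOn_iff_continuous_domRestrict]
    convert continuousOn_univ.1 hkc using 1
    ext y
    simp
  · intro y hy z hz h
    dsimp only at h
    rw [dif_pos hy, dif_pos hz] at h
    exact congrArg Subtype.val (hki trivial trivial h)

end

end OrdinalCleavability

/-- A compact space cleavable over an ordinal is homeomorphic to an ordinal. Cleavability is all that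
the proof uses: spines are not needed. -/
theorem theorem1p12 {X : Type u} [TopologicalSpace X] [CompactSpace X] (l : Ordinal.{u})
    (hcleave : OrdinalCleavability.CleavableOver X (Set.Iio l))
    (hspine : OrdinalCleavability.HereditarilyHasSpine X l) :
    ∃ b : Ordinal.{u}, Nonempty (X ≃ₜ Set.Iio b) :=
  OrdinalCleavability.exists_homeomorph_Iio hcleave.cleavableOverOrdinals.injectsInOrdinal_univ
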